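/- Let $f:\mathbb{R}\to\mathbb{R}$ be continuous, odd and increasing (in the sense of nondecreasing), with $f(0)=0$ and $xf(x)>0$ for all $x\neq 0$. Suppose that (i) there are $\epsilon_0\in(0,1)$ and a function $\underline{\Phi}_f$ with $\liminf_{x\to0^+} \frac{f((1-\epsilon)x)}{f(x)}=\underline{\Phi}_f(\epsilon)>0$ for all $\epsilon\in(0,\epsilon_0)$, and $\underline{\Phi}_f(\epsilon)\to 1$ as $\epsilon\to 0^+$; (ii) $\limsup_{x\to0^+} \frac{f(\mu x)}{f(x)}<\mu$ for all $\mu\in(0,1)$. Let $F(x)=\int_x^1 \frac{du}{f(u)}$ for $x>0$, and let $F^{-1}$ be the inverse of the strictly decreasing function $F$ on $(0,\infty)$. Let $g:[0,\infty)\to\mathbb{R}$ be continuous and such that $\lim_{t\to\infty}\int_0^t g(s)\,ds$ exists and is finite, and put $\Gamma(t)=-\int_t^\infty g(s)\,ds=-\lim_{T\to\infty}\int_t^T g(s)\,ds$ for $t\ge 0$. Suppose that \[ \lim_{t\to\infty}\frac{\Gamma(t)}{F^{-1}(t)}=0 . \] Let $\xi\in\mathbb{R}$, and let $x$ be a continuous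 solution on $[0,\infty)$ of \[ x'(t)=-f(x(t))+g(t),\quad t>0;\qquad x(0)=\xi . \] Then there is $\lambda\in\{-1,0,1\}$ such that \[ \lim_{t\to\infty}\frac{x(t)}{F^{-1}(t)}=\lambda . \] -/

import Mathlib

open Filter Topology Set

noncomputable section

namespace PerturbedODE

/-- Zero is the unique globally stable equilibrium of `y' = -f(y)`. -/
def GloballyStable (f : ℝ → ℝ) : Prop :=
  (∀ x : ℝ, x ≠ 0 → 0 < x * f x) ∧ f 0 = 0

/-- `f` is asymptotic preserving at zero: for all sufficiently small `ε > 0` the number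
`Φ(ε) = liminf_{x → 0+} f((1-ε)x) / f(x)` is positive, and `Φ(ε) → 1` as `ε → 0+`.
(For `f` nondecreasing and positive on `(0,∞)` the quotient lies in `(0,1]`, so the real-valued
`liminf` is the true one.) -/
def AsymptoticPreserving (f : ℝ → ℝ) : Prop :=
  ∃ Φ : ℝ → ℝ, ∃ ε₀ ∈ Ioo (0 : ℝ) 1,
    (∀ ε ∈ Ioo (0 : ℝ) ε₀,
      0 < Φ ε ∧ liminf (fun x : ℝ => f ((1 - ε) * x) / f x) (𝓝[>] 0) = Φ ε) ∧
    Tendsto Φ (𝓝[>] 0) (𝓝 1)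

/-- `limsup_{x → 0+} f(μx) / f(x) < μ` for every `μ ∈ (0,1)`. (Again the quotient lies in `(0,1]`
for `f` nondecreasing and positive on `(0,∞)`.) -/
def SubproportionalAtZero (f : ℝ → ℝ) : Prop :=
  ∀ μ ∈ Ioo (0 : ℝ) 1, limsup (fun x : ℝ => f (μ * x) / f x) (𝓝[>] 0) < μ

/-- `F(x) = ∫_x^1 du / f(u)`, used for `x > 0`. -/
def decayF (f : ℝ → ℝ) (x : ℝ) : ℝ := ∫ u in x..1, 1 / f u

/-- The inverse of `F : (0,∞) → ℝ`. -/
def decayFInv (f : ℝ → ℝ) : ℝ → ℝ := Function.invFunOn (decayF f) (Ioi 0)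

/-- `∫_0^∞ g` converges as an improper integral (not necessarily absolutely):
`lim_{t → ∞} ∫_0^t g(s) ds` exists and is finite. -/
def ImproperConvergent (g : ℝ → ℝ) : Prop :=
  ∃ L : ℝ, Tendsto (fun t : ℝ => ∫ s in (0 : ℝ)..t, g s) atTop (𝓝 L)

/-- `Γ(t) = -∫_t^∞ g(s) ds`, the integral being the improper one,
`∫_t^∞ g(s) ds = lim_{T → ∞} ∫_t^T g(s) ds`. -/
def tailGamma (g : ℝ → ℝ) (t : ℝ) : ℝ :=
  -limUnder atTop (fun T : ℝ => ∫ s in t..T, g s)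

/-- `x` is a continuous solution on `[0,∞)` of `x'(t) = -f(x(t)) + g(t)`, `t > 0`, `x(0) = ξ`. -/
def IsSolution (f g : ℝ → ℝ) (ξ : ℝ) (x : ℝ → ℝ) : Prop :=
  ContinuousOn x (Ici 0) ∧ x 0 = ξ ∧ ∀ t : ℝ, 0 < t → HasDerivAt x (-f (x t) + g t) t

end PerturbedODE

end

/-! Write `y` for the inverse of `F`, so `y' = -f(y)` and `y → 0`. Subtracting `Γ` from `x` removes
`g`: `z = x - Γ` solves `z' = -f(z + Γ)` with `Γ = o(y)`, and `x/y`, `z/y` have the same limit.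

Trajectories are compared through `F`, since `F(v)` grows at the relative rate `-v'/f(v)`.
Subproportionality gives `κ y`, `κ > 1`, a rate bounded below 1, and `l y`, `0 < l < 1`, a rate
bounded above 1. Asymptotic preservation makes the rate of `z` close to 1 wherever `z ≥ c y`,
because there `Γ` is a small fraction of `z`. Hence `z` must drop below `κ y` and stay there
(`eventually_le_mul`). If `z ≥ c y` at arbitrarily large times for some `c` in `(0,1)`, then `z`
stays above `c y` and finally above every `l y`. So `z/y` tends to 1 or has upper limit at most 0;
oddness gives the same for `-z`. -/

open MeasureTheory

namespace PerturbedODE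

/-! ### Differential inequalities on a half-line -/

/-- A differentiable function that starts below a barrier stays below it, if its derivative is
smaller than that of the barrier whenever they meet. -/
theorem le_of_hasDerivAt_lt_of_eq {z z' u u' : ℝ → ℝ} {T : ℝ}
    (hz : ∀ t, T ≤ t → HasDerivAt z (z' t) t) (hu : ∀ t, T ≤ t → HasDerivAt u (u' t) t)
    (hlt : ∀ t, T ≤ t → z t = u t → z' t < u' t) (hT : z T ≤ u T) {t : ℝ} (ht : T ≤ t) :
    z t ≤ u t :=
  image_le_of_deriv_right_lt_deriv_boundary' (a := T) (b := t)
    (fun s hs => (hz s hs.1).continuousAt.continuousWithinAt)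
    (fun s hs => (hz s hs.1).hasDerivWithinAt) hT
    (fun s hs => (hu s hs.1).continuousAt.continuousWithinAt)
    (fun s hs => (hu s hs.1).hasDerivWithinAt)
    (fun s hs => hlt s hs.1) ⟨ht, le_rfl⟩

/-- A function whose derivative is eventually at most `-c < 0` tends to `-∞`. -/
theorem tendsto_atBot_of_hasDerivAt_le {h h' : ℝ → ℝ} {c : ℝ} (hc : 0 < c)
    (hh : ∀ᶠ t in atTop, HasDerivAt h (h' t) t ∧ h' t ≤ -c) : Tendsto h atTop atBot := by
  obtain ⟨T, hT⟩ := eventually_atTop.1 hh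
  have key : ∀ t, T ≤ t → h t ≤ h T + -c * (t - T) := by
    intro t ht
    have := (convex_Ici T).image_sub_le_mul_sub_of_deriv_le (f := h) (C := -c)
      (fun s hs => (hT s hs).1.continuousAt.continuousWithinAt)
      (fun s hs => (hT s (interior_subset hs)).1.differentiableAt.differentiableWithinAt)
      (fun s hs => by rw [(hT s (interior_subset hs)).1.deriv]; exact (hT s (interior_subset hs)).2)
      T self_mem_Ici t ht ht
    linarith
  refine tendsto_atBot_mono' atTop ((eventually_ge_atTop T).mono key) ?_
  refine tendsto_atBot_add_const_left _ _ ?_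
  exact (tendsto_atTop_add_const_right _ (-T) tendsto_id).const_mul_atTop_of_neg (neg_neg_of_pos hc)

/-! ### Consequences of the hypotheses on `f` -/

theorem GloballyStable.pos {f : ℝ → ℝ} (hf : GloballyStable f) {x : ℝ} (hx : 0 < x) : 0 < f x :=
  pos_of_mul_pos_right (hf.1 x hx.ne') hx.le

theorem quotient_mem_Icc {f : ℝ → ℝ} (hm : Monotone f) (hs : GloballyStable f) {μ x : ℝ}
    (h0 : 0 < μ) (h1 : μ < 1) (hx : 0 < x) : f (μ * x) / f x ∈ Icc (0 : ℝ) 1 :=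
  ⟨(div_pos (hs.pos (mul_pos h0 hx)) (hs.pos hx)).le,
    (div_le_one (hs.pos hx)).2 (hm (by nlinarith))⟩

theorem AsymptoticPreserving.exists_eventually_mul_le {f : ℝ → ℝ} (hf : AsymptoticPreserving f)
    (hm : Monotone f) (hs : GloballyStable f) {a : ℝ} (ha : a < 1) :
    ∃ ε ∈ Ioo (0 : ℝ) 1, ∀ᶠ x in 𝓝[>] (0 : ℝ), a * f x ≤ f ((1 - ε) * x) := by
  obtain ⟨Φ, ε₀, hε₀, hΦ, hlim⟩ := hf
  have hmem : ∀ᶠ ε in 𝓝[>] (0 : ℝ), ε ∈ Ioo 0 ε₀ := Ioo_mem_nhdsGT hε₀.1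
  obtain ⟨ε, hε, haε⟩ := (hmem.and (hlim.eventually_const_lt ha)).exists
  have hε1 : ε < 1 := hε.2.trans hε₀.2
  refine ⟨ε, ⟨hε.1, hε1⟩, ?_⟩
  have hbd : IsBoundedUnder (· ≥ ·) (𝓝[>] (0 : ℝ)) (fun x => f ((1 - ε) * x) / f x) := by
    refine isBoundedUnder_of_eventually_ge (a := 0) ?_
    filter_upwards [self_mem_nhdsWithin] with x hx
    exact (quotient_mem_Icc hm hs (by linarith) (by linarith [hε.1]) hx).1
  rw [← (hΦ ε hε).2] at haε
  filter_upwards [eventually_lt_of_lt_liminf haε hbd, self_mem_nhdsWithin] with x hx hx0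
  exact ((lt_div_iff₀ (hs.pos hx0)).1 hx).le

theorem SubproportionalAtZero.exists_eventually_le {f : ℝ → ℝ} (hf : SubproportionalAtZero f)
    (hm : Monotone f) (hs : GloballyStable f) {μ : ℝ} (hμ : μ ∈ Ioo (0 : ℝ) 1) :
    ∃ ν ∈ Ioo 0 μ, ∀ᶠ x in 𝓝[>] (0 : ℝ), f (μ * x) ≤ ν * f x := by
  -- The maximum with 0 keeps `ν` positive, so that the rate `l / ν` makes sense later.
  obtain ⟨ν, hν, hνμ⟩ := exists_between (max_lt (hf μ hμ) hμ.1)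
  have hbd : IsBoundedUnder (· ≤ ·) (𝓝[>] (0 : ℝ)) (fun x => f (μ * x) / f x) := by
    refine isBoundedUnder_of_eventually_le (a := 1) ?_
    filter_upwards [self_mem_nhdsWithin] with x hx
    exact (quotient_mem_Icc hm hs hμ.1 hμ.2 hx).2
  refine ⟨ν, ⟨(le_max_right _ _).trans_lt hν, hνμ⟩, ?_⟩
  filter_upwards [eventually_lt_of_limsup_lt ((le_max_left _ _).trans_lt hν) hbd,
    self_mem_nhdsWithin] with x hx hx0
  exact ((div_lt_iff₀ (hs.pos hx0)).1 hx).le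

/-! ### The function `F` and its inverse -/

theorem intervalIntegrable_one_div {f : ℝ → ℝ} (hc : Continuous f) (hs : GloballyStable f)
    {a b : ℝ} (ha : 0 < a) (hb : 0 < b) :
    IntervalIntegrable (fun u => 1 / f u) volume a b := by
  refine ContinuousOn.intervalIntegrable (continuousOn_const.div hc.continuousOn ?_)
  intro u hu
  exact (hs.pos ((lt_min ha hb).trans_le hu.1)).ne'

theorem hasDerivAt_decayF {f : ℝ → ℝ} (hc : Continuous f) (hs : GloballyStable f) {a : ℝ}
    (ha : 0 < a) : HasDerivAt (decayF f) (-(1 / f a)) a := by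
  have hcont : ContinuousOn (fun u => 1 / f u) (Ioi 0) :=
    continuousOn_const.div hc.continuousOn fun u hu => (hs.pos hu).ne'
  exact intervalIntegral.integral_hasDerivAt_left (intervalIntegrable_one_div hc hs ha one_pos)
    (hcont.stronglyMeasurableAtFilter isOpen_Ioi a ha) (hcont.continuousAt (Ioi_mem_nhds ha))

theorem strictAntiOn_decayF {f : ℝ → ℝ} (hc : Continuous f) (hs : GloballyStable f) :
    StrictAntiOn (decayF f) (Ioi 0) := by
  refine strictAntiOn_of_deriv_neg (convex_Ioi 0)
    (fun a ha => (hasDerivAt_decayF hc hs ha).continuousAt.continuousWithinAt) fun a ha => ?_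
  rw [interior_Ioi] at ha
  rw [(hasDerivAt_decayF hc hs ha).deriv]
  exact neg_neg_of_pos (one_div_pos.2 (hs.pos ha))

theorem decayF_half_ge {f : ℝ → ℝ} (hc : Continuous f) (hm : Monotone f) (hs : GloballyStable f)
    {a : ℝ} (ha : 0 < a) : decayF f a + a / (2 * f a) ≤ decayF f (a / 2) := by
  have h2 : 0 < a / 2 := by positivity
  have hadd : decayF f (a / 2) = (∫ u in (a / 2)..a, 1 / f u) + decayF f a :=
    (intervalIntegral.integral_add_adjacent_intervals (intervalIntegrable_one_div hc hs h2 ha)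
      (intervalIntegrable_one_div hc hs ha one_pos)).symm
  have hge : (∫ _ in (a / 2)..a, 1 / f a) ≤ ∫ u in (a / 2)..a, 1 / f u := by
    refine intervalIntegral.integral_mono_on (by linarith) intervalIntegrable_const
      (intervalIntegrable_one_div hc hs h2 ha) fun u hu => ?_
    exact one_div_le_one_div_of_le (hs.pos (h2.trans_le hu.1)) (hm hu.2)
  rw [intervalIntegral.integral_const, smul_eq_mul] at hge
  have heq : (a - a / 2) * (1 / f a) = a / (2 * f a) := by
    have := (hs.pos ha).ne'
    field_simp
    ring
  linarith

/-- `F` is unbounded near zero, because `f` is at most linear there. -/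
theorem exists_decayF_ge {f : ℝ → ℝ} (hc : Continuous f) (hm : Monotone f) (hs : GloballyStable f)
    (hsub : SubproportionalAtZero f) (K : ℝ) : ∃ a, 0 < a ∧ a ≤ 1 ∧ K ≤ decayF f a := by
  obtain ⟨ν, hν, hev⟩ := hsub.exists_eventually_le hm hs (μ := 1 / 2) (by norm_num)
  obtain ⟨δ, hδ, hδf⟩ := mem_nhdsGT_iff_exists_Ioo_subset.1 hev
  have hδ0 : (0 : ℝ) < δ := hδ
  set b : ℝ := min (δ / 2) 1 with hb
  have hb0 : 0 < b := lt_min (by positivity) one_pos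
  have hbδ : b < δ := (min_le_left _ _).trans_lt (by linarith)
  have hfb := hs.pos hb0
  -- Halving the argument at least halves `f`, so the ratio of argument to value never decreases and
  -- each dyadic interval adds at least `b / (2 f(b))` to `F`.
  have key : ∀ n : ℕ, f (b / 2 ^ n) ≤ f b / 2 ^ n ∧
      decayF f b + n * (b / (2 * f b)) ≤ decayF f (b / 2 ^ n) := by
    intro n
    induction n with
    | zero => simp
    | succ n ih =>
      have hbn : 0 < b / 2 ^ n := by positivity
      have hle : b / 2 ^ n ≤ b := div_le_self hb0.le (one_le_pow₀ (by norm_num))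
      have hstep : f (1 / 2 * (b / 2 ^ n)) ≤ ν * f (b / 2 ^ n) := hδf ⟨hbn, hle.trans_lt hbδ⟩
      have hpos := hs.pos hbn
      have hrw : b / 2 ^ (n + 1) = b / 2 ^ n / 2 := by rw [pow_succ, div_div]
      have hrw' : f b / 2 ^ (n + 1) = f b / 2 ^ n / 2 := by rw [pow_succ, div_div]
      rw [hrw, hrw']
      constructor
      · have : f (b / 2 ^ n / 2) ≤ ν * f (b / 2 ^ n) := by
          rwa [one_div_mul_eq_div] at hstep
        nlinarith [ih.1, hν.2]
      · have h1 := decayF_half_ge hc hm hs hbn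
        have h2 : b / (2 * f b) ≤ b / 2 ^ n / (2 * f (b / 2 ^ n)) := by
          rw [div_le_div_iff₀ (by positivity) (by positivity)]
          have h3 := mul_le_mul_of_nonneg_left ih.1 hb0.le
          calc b * (2 * f (b / 2 ^ n)) = 2 * (b * f (b / 2 ^ n)) := by ring
            _ ≤ 2 * (b * (f b / 2 ^ n)) := by linarith
            _ = b / 2 ^ n * (2 * f b) := by ring
        push_cast
        linarith [ih.2]
  obtain ⟨n, hn⟩ := exists_nat_ge ((K - decayF f b) / (b / (2 * f b)))
  rw [div_le_iff₀ (by positivity)] at hn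
  exact ⟨b / 2 ^ n, by positivity,
    (div_le_self hb0.le (one_le_pow₀ (by norm_num))).trans (min_le_right _ _),
    by linarith [(key n).2]⟩

/-- `F` may be bounded below, so it need not reach negative values; `F(1) = 0` and unboundedness
near 0 cover all `t ≥ 0`. -/
theorem exists_decayF_eq {f : ℝ → ℝ} (hc : Continuous f) (hm : Monotone f) (hs : GloballyStable f)
    (hsub : SubproportionalAtZero f) {t : ℝ} (ht : 0 ≤ t) : ∃ a ∈ Ioi (0 : ℝ), decayF f a = t := by
  obtain ⟨a, ha, ha1, hat⟩ := exists_decayF_ge hc hm hs hsub t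
  have h1 : decayF f 1 ≤ t := by simpa [decayF] using ht
  obtain ⟨b, hb, hbt⟩ := intermediate_value_Icc' ha1 (f := decayF f)
    (fun u hu => (hasDerivAt_decayF hc hs (ha.trans_le hu.1)).continuousAt.continuousWithinAt)
    ⟨h1, hat⟩
  exact ⟨b, ha.trans_le hb.1, hbt⟩

theorem decayFInv_pos {f : ℝ → ℝ} (hc : Continuous f) (hm : Monotone f) (hs : GloballyStable f)
    (hsub : SubproportionalAtZero f) {t : ℝ} (ht : 0 ≤ t) : 0 < decayFInv f t :=
  Function.invFunOn_mem (exists_decayF_eq hc hm hs hsub ht)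

theorem decayF_decayFInv {f : ℝ → ℝ} (hc : Continuous f) (hm : Monotone f) (hs : GloballyStable f)
    (hsub : SubproportionalAtZero f) {t : ℝ} (ht : 0 ≤ t) : decayF f (decayFInv f t) = t :=
  Function.invFunOn_eq (exists_decayF_eq hc hm hs hsub ht)

theorem decayFInv_lt_iff {f : ℝ → ℝ} (hc : Continuous f) (hm : Monotone f) (hs : GloballyStable f)
    (hsub : SubproportionalAtZero f) {t a : ℝ} (ht : 0 ≤ t) (ha : 0 < a) :
    decayFInv f t < a ↔ decayF f a < t := by
  conv_rhs => rw [← decayF_decayFInv hc hm hs hsub ht]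
  exact ((strictAntiOn_decayF hc hs).lt_iff_gt ha (decayFInv_pos hc hm hs hsub ht)).symm

theorem lt_decayFInv_iff {f : ℝ → ℝ} (hc : Continuous f) (hm : Monotone f) (hs : GloballyStable f)
    (hsub : SubproportionalAtZero f) {t a : ℝ} (ht : 0 ≤ t) (ha : 0 < a) :
    a < decayFInv f t ↔ t < decayF f a := by
  conv_rhs => rw [← decayF_decayFInv hc hm hs hsub ht]
  exact ((strictAntiOn_decayF hc hs).lt_iff_gt (decayFInv_pos hc hm hs hsub ht) ha).symm

theorem continuousAt_decayFInv {f : ℝ → ℝ} (hc : Continuous f) (hm : Monotone f)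
    (hs : GloballyStable f) (hsub : SubproportionalAtZero f) {t : ℝ} (ht : 0 < t) :
    ContinuousAt (decayFInv f) t := by
  have hpos : ∀ᶠ s in 𝓝 t, 0 < s := eventually_gt_nhds ht
  refine tendsto_order.2 ⟨fun a ha => ?_, fun a ha => ?_⟩
  · rcases le_or_gt a 0 with h0 | h0
    · filter_upwards [hpos] with s hst
      exact h0.trans_lt (decayFInv_pos hc hm hs hsub hst.le)
    · filter_upwards [hpos,
        eventually_lt_nhds ((lt_decayFInv_iff hc hm hs hsub ht.le h0).1 ha)] with s hst hsa
      exact (lt_decayFInv_iff hc hm hs hsub hst.le h0).2 hsa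
  · have h0 := (decayFInv_pos hc hm hs hsub ht.le).trans ha
    filter_upwards [hpos,
      eventually_gt_nhds ((decayFInv_lt_iff hc hm hs hsub ht.le h0).1 ha)] with s hst hsa
    exact (decayFInv_lt_iff hc hm hs hsub hst.le h0).2 hsa

theorem hasDerivAt_decayFInv {f : ℝ → ℝ} (hc : Continuous f) (hm : Monotone f)
    (hs : GloballyStable f) (hsub : SubproportionalAtZero f) {t : ℝ} (ht : 0 < t) :
    HasDerivAt (decayFInv f) (-f (decayFInv f t)) t := by
  have hy := decayFInv_pos hc hm hs hsub ht.le
  have h := HasDerivAt.of_local_left_inverse (continuousAt_decayFInv hc hm hs hsub ht)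
    (hasDerivAt_decayF hc hs hy) (neg_ne_zero.2 (one_div_ne_zero (hs.pos hy).ne'))
    ((eventually_gt_nhds ht).mono fun s hst => decayF_decayFInv hc hm hs hsub (le_of_lt hst))
  simpa [inv_neg] using h

theorem tendsto_decayFInv {f : ℝ → ℝ} (hc : Continuous f) (hm : Monotone f)
    (hs : GloballyStable f) (hsub : SubproportionalAtZero f) :
    Tendsto (decayFInv f) atTop (𝓝 0) := by
  refine tendsto_order.2 ⟨fun a ha => ?_, fun a ha => ?_⟩
  · filter_upwards [eventually_ge_atTop 0] with t ht
    exact ha.trans (decayFInv_pos hc hm hs hsub ht)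
  · filter_upwards [eventually_ge_atTop 0, eventually_gt_atTop (decayF f a)] with t ht hta
    exact (decayFInv_lt_iff hc hm hs hsub ht ha).2 hta

/-! ### The tail of the perturbation -/

theorem exists_tailGamma_eq {g : ℝ → ℝ} (hg : ContinuousOn g (Ici 0)) (hi : ImproperConvergent g) :
    ∃ L : ℝ, ∀ t, 0 ≤ t → tailGamma g t = (∫ s in (0 : ℝ)..t, g s) - L := by
  obtain ⟨L, hL⟩ := hi
  have hint : ∀ a b : ℝ, 0 ≤ a → 0 ≤ b → IntervalIntegrable g volume a b := fun a b ha hb =>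
    (hg.mono fun u hu => (le_min ha hb).trans hu.1).intervalIntegrable
  refine ⟨L, fun t ht => ?_⟩
  have h : Tendsto (fun T : ℝ => ∫ s in t..T, g s) atTop (𝓝 (L - ∫ s in (0 : ℝ)..t, g s)) := by
    refine (hL.sub_const _).congr' ?_
    filter_upwards [eventually_ge_atTop 0] with T hT
    exact intervalIntegral.integral_interval_sub_left (hint 0 T le_rfl hT) (hint 0 t le_rfl ht)
  rw [tailGamma, h.limUnder_eq]
  ring

theorem hasDerivAt_tailGamma {g : ℝ → ℝ} (hg : ContinuousOn g (Ici 0)) (hi : ImproperConvergent g)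
    {t : ℝ} (ht : 0 < t) : HasDerivAt (tailGamma g) (g t) t := by
  obtain ⟨L, hL⟩ := exists_tailGamma_eq hg hi
  have hint : IntervalIntegrable g volume 0 t :=
    (hg.mono fun u hu => (le_min le_rfl ht.le).trans hu.1).intervalIntegrable
  have hg' : ContinuousOn g (Ioi 0) := hg.mono Ioi_subset_Ici_self
  have h := (intervalIntegral.integral_hasDerivAt_right hint
    (hg'.stronglyMeasurableAtFilter isOpen_Ioi t ht)
    (hg'.continuousAt (Ioi_mem_nhds ht))).sub_const L
  exact h.congr_of_eventuallyEq ((eventually_gt_nhds ht).mono fun s hs => hL s (le_of_lt hs))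

/-! ### Solutions of `z' = -f(z + Γ)` with `Γ` small -/

/-- Once `Γ > -ε/2`, having `z ≥ ε` forces `z' ≤ -f(ε/2) < 0`: `z` must come down to `ε` and cannot
cross it upwards again. -/
theorem eventually_le_of_tendsto_zero {f z Γ : ℝ → ℝ} (hm : Monotone f) (hs : GloballyStable f)
    (hΓ : Tendsto Γ atTop (𝓝 0)) (hz : ∀ t, 0 < t → HasDerivAt z (-f (z t + Γ t)) t)
    {ε : ℝ} (hε : 0 < ε) : ∀ᶠ t in atTop, z t ≤ ε := by
  have hfε : 0 < f (ε / 2) := hs.pos (by positivity)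
  have hslow : ∀ᶠ t in atTop, 0 < t ∧ (ε ≤ z t → -f (z t + Γ t) ≤ -f (ε / 2)) := by
    filter_upwards [eventually_gt_atTop 0,
      hΓ.eventually_const_lt (show -(ε / 2) < 0 by linarith)] with t ht hΓt
    exact ⟨ht, fun h => neg_le_neg (hm (by linarith))⟩
  have hfreq : ∃ᶠ t in atTop, z t ≤ ε := by
    intro hnot
    have hbot : Tendsto z atTop atBot := by
      refine tendsto_atBot_of_hasDerivAt_le hfε (h' := fun t => -f (z t + Γ t)) ?_
      filter_upwards [hslow, hnot] with t ht hn
      exact ⟨hz t ht.1, ht.2 (not_le.1 hn).le⟩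
    obtain ⟨t, h1, h2⟩ := (hnot.and (hbot.eventually_le_atBot ε)).exists
    exact h1 h2
  obtain ⟨S, hS⟩ := eventually_atTop.1 hslow
  obtain ⟨T, hST, hT⟩ := frequently_atTop.1 hfreq S
  filter_upwards [eventually_ge_atTop T] with t ht
  refine le_of_hasDerivAt_lt_of_eq (u := fun _ => ε) (u' := fun _ => 0)
    (fun s hs => hz s (hS s (hST.trans hs)).1) (fun s _ => hasDerivAt_const s ε)
    (fun s hs he => ?_) hT ht
  linarith [(hS s (hST.trans hs)).2 he.ge]

/-- Near zero, a perturbation `Γ = o(y)` is negligible in `f (z + Γ)` as long as `z ≥ c y`. -/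
theorem eventually_mul_le_and_mul_le {f z Γ y : ℝ → ℝ} (hm : Monotone f) (hs : GloballyStable f)
    (hap : AsymptoticPreserving f) (hypos : ∀ t, 0 < t → 0 < y t)
    (hΓy : Tendsto (fun t => Γ t / y t) atTop (𝓝 0)) (hz0 : Tendsto z atTop (𝓝 0))
    {a c : ℝ} (ha : a < 1) (hc : 0 < c) :
    ∀ᶠ t in atTop, c * y t ≤ z t →
      a * f (z t) ≤ f (z t + Γ t) ∧ a * f (z t + Γ t) ≤ f (z t) := by
  obtain ⟨ε, hε, hev⟩ := hap.exists_eventually_mul_le hm hs ha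
  obtain ⟨δ, hδ, hδf⟩ := mem_nhdsGT_iff_exists_Ioo_subset.1 hev
  have hδ0 : (0 : ℝ) < δ := hδ
  have hεc : 0 < ε * c := mul_pos hε.1 hc
  filter_upwards [eventually_gt_atTop 0, hΓy.eventually_const_lt (neg_neg_of_pos hεc),
    hΓy.eventually_lt_const hεc, hz0.eventually_lt_const (half_pos hδ0)] with t ht h1 h2 h3 hzt
  have hy := hypos t ht
  rw [lt_div_iff₀ hy] at h1
  rw [div_lt_iff₀ hy] at h2
  have hzpos : 0 < z t := (mul_pos hc hy).trans_le hzt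
  have hεz : ε * c * y t ≤ ε * z t := by nlinarith [mul_le_mul_of_nonneg_left hzt hε.1.le]
  constructor
  · have h4 : a * f (z t) ≤ f ((1 - ε) * z t) := hδf ⟨hzpos, by linarith⟩
    exact h4.trans (hm (by linarith))
  -- `|Γ| < ε z` gives `z + Γ < 2 z < δ`, whence the bound `δ / 2` on `z`.
  · have hw : z t + Γ t ∈ Ioo 0 δ := ⟨by nlinarith [hε.2], by nlinarith [hε.2]⟩
    have h4 : a * f (z t + Γ t) ≤ f ((1 - ε) * (z t + Γ t)) := hδf hw
    refine h4.trans (hm ?_)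
    -- This is `(1 - ε)(z + Γ) ≤ (1 - ε)(1 + ε) z ≤ z`.
    nlinarith [hε.1, hε.2, mul_pos (mul_pos hε.1 hε.1) hzpos,
      mul_lt_mul_of_pos_left (h2.trans_le hεz) (sub_pos.2 hε.2)]

theorem hasDerivAt_decayF_comp {f v : ℝ → ℝ} (hc : Continuous f) (hs : GloballyStable f)
    {v' t : ℝ} (hv : HasDerivAt v v' t) (hpos : 0 < v t) :
    HasDerivAt (fun s => decayF f (v s)) (-(v' / f (v t))) t := by
  refine ((hasDerivAt_decayF hc hs hpos).comp t hv).congr_deriv ?_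
  ring

/-- A solution of the perturbed equation eventually lies below `κ y` for every `κ > 1`. -/
theorem eventually_le_mul {f z Γ y : ℝ → ℝ} (hc : Continuous f) (hm : Monotone f)
    (hs : GloballyStable f) (hap : AsymptoticPreserving f) (hsub : SubproportionalAtZero f)
    (hypos : ∀ t, 0 < t → 0 < y t) (hy : ∀ t, 0 < t → HasDerivAt y (-f (y t)) t)
    (hy0 : Tendsto y atTop (𝓝 0)) (hΓy : Tendsto (fun t => Γ t / y t) atTop (𝓝 0))
    (hz : ∀ t, 0 < t → HasDerivAt z (-f (z t + Γ t)) t) (hz0 : Tendsto z atTop (𝓝 0))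
    {κ : ℝ} (hκ : 1 < κ) : ∀ᶠ t in atTop, z t ≤ κ * y t := by
  have hκ0 : 0 < κ := one_pos.trans hκ
  obtain ⟨ν, hν, hev⟩ := hsub.exists_eventually_le hm hs (μ := κ⁻¹)
    ⟨inv_pos.2 hκ0, inv_lt_one_of_one_lt₀ hκ⟩
  have hq : κ * ν < 1 := by
    have := mul_lt_mul_of_pos_left hν.2 hκ0
    rwa [mul_inv_cancel₀ hκ0.ne'] at this
  obtain ⟨a, hqa, ha⟩ := exists_between hq
  have hu0 : Tendsto (fun t => κ * y t) atTop (𝓝[>] 0) := by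
    refine tendsto_nhdsWithin_iff.2 ⟨by simpa using hy0.const_mul κ, ?_⟩
    filter_upwards [eventually_gt_atTop 0] with t ht
    exact mul_pos hκ0 (hypos t ht)
  have hu : ∀ t, 0 < t → HasDerivAt (fun s => κ * y s) (κ * -f (y t)) t :=
    fun t ht => (hy t ht).const_mul κ
  have hrate : ∀ᶠ t in atTop, 0 < t ∧ κ * f (y t) ≤ κ * ν * f (κ * y t) ∧
      (κ * y t ≤ z t → a * f (z t) ≤ f (z t + Γ t)) := by
    filter_upwards [eventually_gt_atTop 0, hu0.eventually hev,
      eventually_mul_le_and_mul_le hm hs hap hypos hΓy hz0 ha hκ0] with t ht h1 h2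
    rw [inv_mul_cancel_left₀ hκ0.ne'] at h1
    exact ⟨ht, by nlinarith, fun h => (h2 h).1⟩
  have hfreq : ∃ᶠ t in atTop, z t ≤ κ * y t := by
    intro hnot
    -- While `z > κ y` this difference is positive, yet its derivative is at most `κ ν - a < 0`.
    have hbot : Tendsto (fun t => decayF f (κ * y t) - decayF f (z t)) atTop atBot := by
      refine tendsto_atBot_of_hasDerivAt_le (sub_pos.2 hqa)
        (h' := fun t => -(κ * -f (y t) / f (κ * y t)) - -(-f (z t + Γ t) / f (z t))) ?_
      filter_upwards [hrate, hnot] with t ht hn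
      have hupos : 0 < κ * y t := mul_pos hκ0 (hypos t ht.1)
      have hzu := not_le.1 hn
      have hzpos := hupos.trans hzu
      refine ⟨(hasDerivAt_decayF_comp hc hs (hu t ht.1) hupos).sub
        (hasDerivAt_decayF_comp hc hs (hz t ht.1) hzpos), ?_⟩
      have h1 : κ * f (y t) / f (κ * y t) ≤ κ * ν := (div_le_iff₀ (hs.pos hupos)).2 ht.2.1
      have h2 : a ≤ f (z t + Γ t) / f (z t) := (le_div_iff₀ (hs.pos hzpos)).2 (ht.2.2 hzu.le)
      rw [mul_neg, neg_div, neg_div]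
      linarith
    obtain ⟨t, ⟨h1, h2⟩, h3⟩ := ((hnot.and (hbot.eventually_le_atBot 0)).and
      (eventually_gt_atTop 0)).exists
    have hupos : 0 < κ * y t := mul_pos hκ0 (hypos t h3)
    have hzu := not_le.1 h1
    linarith [strictAntiOn_decayF hc hs hupos (hupos.trans hzu) hzu]
  obtain ⟨S, hS⟩ := eventually_atTop.1 hrate
  obtain ⟨T, hST, hT⟩ := frequently_atTop.1 hfreq S
  filter_upwards [eventually_ge_atTop T] with t ht
  refine le_of_hasDerivAt_lt_of_eq (fun s hs => hz s (hS s (hST.trans hs)).1)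
    (fun s hs => hu s (hS s (hST.trans hs)).1) (fun s hTs he => ?_) hT ht
  obtain ⟨h0, h1, h2⟩ := hS s (hST.trans hTs)
  have h3 := h2 he.ge
  rw [he] at h3 ⊢
  have hfu := hs.pos (mul_pos hκ0 (hypos s h0))
  nlinarith

/-- While `z ≥ c y`, the relative decay rate of `z` is eventually smaller than that of `l y`,
for every `l < 1`. -/
theorem exists_eventually_rate {f z Γ y : ℝ → ℝ} (hm : Monotone f)
    (hs : GloballyStable f) (hap : AsymptoticPreserving f) (hsub : SubproportionalAtZero f)
    (hypos : ∀ t, 0 < t → 0 < y t)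
    (hy0 : Tendsto y atTop (𝓝 0)) (hΓy : Tendsto (fun t => Γ t / y t) atTop (𝓝 0))
    (hz0 : Tendsto z atTop (𝓝 0)) {l c : ℝ} (hl : l ∈ Ioo (0 : ℝ) 1) (hc : 0 < c) :
    ∃ A B : ℝ, A < B ∧ ∀ᶠ t in atTop, 0 < t ∧ B * f (l * y t) ≤ l * f (y t) ∧
      (c * y t ≤ z t → f (z t + Γ t) ≤ A * f (z t)) := by
  obtain ⟨ν, hν, hev⟩ := hsub.exists_eventually_le hm hs hl
  -- `A > 1` leaves room for the error caused by `Γ`; `l / ν` bounds the rate of `l y` from below.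
  obtain ⟨A, hA1, hAB⟩ := exists_between ((one_lt_div hν.1).2 hν.2)
  have hA0 : 0 < A := one_pos.trans hA1
  have hy0' : Tendsto y atTop (𝓝[>] 0) :=
    tendsto_nhdsWithin_iff.2 ⟨hy0, (eventually_gt_atTop 0).mono hypos⟩
  refine ⟨A, l / ν, hAB, ?_⟩
  filter_upwards [eventually_gt_atTop 0, hy0'.eventually hev,
    eventually_mul_le_and_mul_le hm hs hap hypos hΓy hz0 (inv_lt_one_of_one_lt₀ hA1) hc]
    with t ht h1 h2
  refine ⟨ht, ?_, fun h => (inv_mul_le_iff₀ hA0).1 (h2 h).2⟩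
  calc l / ν * f (l * y t) ≤ l / ν * (ν * f (y t)) :=
        mul_le_mul_of_nonneg_left h1 (div_pos hl.1 hν.1).le
    _ = l * f (y t) := by rw [← mul_assoc, div_mul_cancel₀ _ hν.1.ne']

/-- If a solution of the perturbed equation exceeds `l y` at arbitrarily large times, where
`0 < l < 1`, then it eventually stays above `l y`. -/
theorem eventually_mul_le_of_frequently {f z Γ y : ℝ → ℝ} (hm : Monotone f)
    (hs : GloballyStable f) (hap : AsymptoticPreserving f) (hsub : SubproportionalAtZero f)
    (hypos : ∀ t, 0 < t → 0 < y t) (hy : ∀ t, 0 < t → HasDerivAt y (-f (y t)) t)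
    (hy0 : Tendsto y atTop (𝓝 0)) (hΓy : Tendsto (fun t => Γ t / y t) atTop (𝓝 0))
    (hz : ∀ t, 0 < t → HasDerivAt z (-f (z t + Γ t)) t) (hz0 : Tendsto z atTop (𝓝 0))
    {l : ℝ} (hl : l ∈ Ioo (0 : ℝ) 1) (hfreq : ∃ᶠ t in atTop, l * y t ≤ z t) :
    ∀ᶠ t in atTop, l * y t ≤ z t := by
  obtain ⟨A, B, hAB, hrate⟩ := exists_eventually_rate hm hs hap hsub hypos hy0 hΓy hz0 hl hl.1
  obtain ⟨S, hS⟩ := eventually_atTop.1 hrate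
  obtain ⟨T, hST, hT⟩ := frequently_atTop.1 hfreq S
  filter_upwards [eventually_ge_atTop T] with t ht
  refine le_of_hasDerivAt_lt_of_eq (fun s hs => (hy s (hS s (hST.trans hs)).1).const_mul l)
    (fun s hs => hz s (hS s (hST.trans hs)).1) (fun s hTs he => ?_) hT ht
  obtain ⟨h0, h1, h2⟩ := hS s (hST.trans hTs)
  have h3 := h2 he.le
  rw [← he] at h3 ⊢
  have hfu := hs.pos (mul_pos hl.1 (hypos s h0))
  nlinarith

/-- If a solution of the perturbed equation eventually lies above `c y` with `c > 0`, then it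
eventually lies above `l y` for every `0 < l < 1`. -/
theorem eventually_mul_le_of_eventually {f z Γ y : ℝ → ℝ} (hc : Continuous f) (hm : Monotone f)
    (hs : GloballyStable f) (hap : AsymptoticPreserving f) (hsub : SubproportionalAtZero f)
    (hypos : ∀ t, 0 < t → 0 < y t) (hy : ∀ t, 0 < t → HasDerivAt y (-f (y t)) t)
    (hy0 : Tendsto y atTop (𝓝 0)) (hΓy : Tendsto (fun t => Γ t / y t) atTop (𝓝 0))
    (hz : ∀ t, 0 < t → HasDerivAt z (-f (z t + Γ t)) t) (hz0 : Tendsto z atTop (𝓝 0))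
    {c : ℝ} (hc0 : 0 < c) (hcz : ∀ᶠ t in atTop, c * y t ≤ z t)
    {l : ℝ} (hl : l ∈ Ioo (0 : ℝ) 1) : ∀ᶠ t in atTop, l * y t ≤ z t := by
  refine eventually_mul_le_of_frequently hm hs hap hsub hypos hy hy0 hΓy hz hz0 hl fun hnot => ?_
  obtain ⟨A, B, hAB, hrate⟩ := exists_eventually_rate hm hs hap hsub hypos hy0 hΓy hz0 hl hc0
  -- If `z < l y` persisted, this difference would stay positive.
  have hbot : Tendsto (fun t => decayF f (z t) - decayF f (l * y t)) atTop atBot := by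
    refine tendsto_atBot_of_hasDerivAt_le (sub_pos.2 hAB)
      (h' := fun t => -(-f (z t + Γ t) / f (z t)) - -(l * -f (y t) / f (l * y t))) ?_
    filter_upwards [hrate, hcz] with t ht hczt
    have hvpos : 0 < l * y t := mul_pos hl.1 (hypos t ht.1)
    have hzpos : 0 < z t := (mul_pos hc0 (hypos t ht.1)).trans_le hczt
    refine ⟨(hasDerivAt_decayF_comp hc hs (hz t ht.1) hzpos).sub
      (hasDerivAt_decayF_comp hc hs ((hy t ht.1).const_mul l) hvpos), ?_⟩
    have h1 : B ≤ l * f (y t) / f (l * y t) := (le_div_iff₀ (hs.pos hvpos)).2 ht.2.1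
    have h2 : f (z t + Γ t) / f (z t) ≤ A := (div_le_iff₀ (hs.pos hzpos)).2 (ht.2.2 hczt)
    rw [mul_neg, neg_div, neg_div]
    linarith
  obtain ⟨t, ⟨⟨h1, h2⟩, h3⟩, h4⟩ := (((hnot.and (hbot.eventually_le_atBot 0)).and
    (eventually_gt_atTop 0)).and hcz).exists
  have hzpos : 0 < z t := (mul_pos hc0 (hypos t h3)).trans_le h4
  have hzv := not_le.1 h1
  linarith [strictAntiOn_decayF hc hs hzpos (hzpos.trans hzv) hzv]

/-- The alternative for positive values: `z / y` tends to `1`, or has upper limit at most `0`. -/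
theorem tendsto_one_or_eventually_lt {f z Γ y : ℝ → ℝ} (hc : Continuous f) (hm : Monotone f)
    (hs : GloballyStable f) (hap : AsymptoticPreserving f) (hsub : SubproportionalAtZero f)
    (hypos : ∀ t, 0 < t → 0 < y t) (hy : ∀ t, 0 < t → HasDerivAt y (-f (y t)) t)
    (hy0 : Tendsto y atTop (𝓝 0)) (hΓy : Tendsto (fun t => Γ t / y t) atTop (𝓝 0))
    (hz : ∀ t, 0 < t → HasDerivAt z (-f (z t + Γ t)) t) (hz0 : Tendsto z atTop (𝓝 0)) :
    Tendsto (fun t => z t / y t) atTop (𝓝 1) ∨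
      ∀ l : ℝ, 0 < l → ∀ᶠ t in atTop, z t / y t < l := by
  by_cases hex : ∃ c ∈ Ioo (0 : ℝ) 1, ∃ᶠ t in atTop, c * y t ≤ z t
  · obtain ⟨c, hcmem, hfreq⟩ := hex
    have hcz := eventually_mul_le_of_frequently hm hs hap hsub hypos hy hy0 hΓy hz hz0 hcmem hfreq
    left
    refine tendsto_order.2 ⟨fun b hb => ?_, fun b hb => ?_⟩
    · obtain ⟨l, hbl, hl⟩ := exists_between (max_lt hb one_pos)
      filter_upwards [eventually_gt_atTop 0, eventually_mul_le_of_eventually hc hm hs hap hsub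
        hypos hy hy0 hΓy hz hz0 hcmem.1 hcz ⟨(le_max_right _ _).trans_lt hbl, hl⟩] with t ht h
      exact ((le_max_left _ _).trans_lt hbl).trans_le ((le_div_iff₀ (hypos t ht)).2 h)
    · obtain ⟨κ, hκ, hκb⟩ := exists_between hb
      filter_upwards [eventually_gt_atTop 0, eventually_le_mul hc hm hs hap hsub
        hypos hy hy0 hΓy hz hz0 hκ] with t ht h
      exact ((div_le_iff₀ (hypos t ht)).2 h).trans_lt hκb
  · right
    intro l hl
    obtain ⟨c, hc0, hcl⟩ := exists_between (lt_min hl one_pos)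
    have hnot : ¬ ∃ᶠ t in atTop, c * y t ≤ z t := fun h =>
      hex ⟨c, ⟨hc0, hcl.trans_le (min_le_right _ _)⟩, h⟩
    filter_upwards [eventually_gt_atTop 0, not_frequently.1 hnot] with t ht h
    exact ((div_lt_iff₀ (hypos t ht)).2 (not_le.1 h)).trans (hcl.trans_le (min_le_left _ _))

/-- By oddness `-z` solves the same equation with `-Γ`. If neither `z/y` nor `-z/y` tends to 1, both
have upper limit at most 0, so `z/y → 0`. -/
theorem exists_tendsto_div {f z Γ y : ℝ → ℝ} (hc : Continuous f) (hm : Monotone f)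
    (hodd : Function.Odd f)
    (hs : GloballyStable f) (hap : AsymptoticPreserving f) (hsub : SubproportionalAtZero f)
    (hypos : ∀ t, 0 < t → 0 < y t) (hy : ∀ t, 0 < t → HasDerivAt y (-f (y t)) t)
    (hy0 : Tendsto y atTop (𝓝 0)) (hΓy : Tendsto (fun t => Γ t / y t) atTop (𝓝 0))
    (hz : ∀ t, 0 < t → HasDerivAt z (-f (z t + Γ t)) t) :
    ∃ l ∈ ({-1, 0, 1} : Set ℝ), Tendsto (fun t => z t / y t) atTop (𝓝 l) := by
  have hΓ : Tendsto Γ atTop (𝓝 0) := by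
    have h := hΓy.mul hy0
    rw [zero_mul] at h
    refine h.congr' ?_
    filter_upwards [eventually_gt_atTop 0] with t ht
    exact div_mul_cancel₀ _ (hypos t ht).ne'
  have hnz : ∀ t, 0 < t → HasDerivAt (fun s => -z s) (-f (-z t + -Γ t)) t := fun t ht => by
    refine (hz t ht).fun_neg.congr_deriv ?_
    rw [← neg_add, hodd]
  have hnΓ : Tendsto (fun t => -Γ t) atTop (𝓝 0) := by simpa using hΓ.neg
  have hnΓy : Tendsto (fun t => -Γ t / y t) atTop (𝓝 0) := by
    simpa [neg_div] using hΓy.neg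
  have hz0 : Tendsto z atTop (𝓝 0) := by
    refine tendsto_order.2 ⟨fun b hb => ?_, fun b hb => ?_⟩
    · filter_upwards [eventually_le_of_tendsto_zero hm hs hnΓ hnz
        (half_pos (neg_pos.2 hb))] with t ht
      linarith
    · filter_upwards [eventually_le_of_tendsto_zero hm hs hΓ hz (half_pos hb)] with t ht
      linarith
  have hnz0 : Tendsto (fun t => -z t) atTop (𝓝 0) := by simpa using hz0.neg
  rcases tendsto_one_or_eventually_lt hc hm hs hap hsub hypos hy hy0 hΓy hz hz0 with h | hup
  · exact ⟨1, by simp, h⟩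
  rcases tendsto_one_or_eventually_lt hc hm hs hap hsub hypos hy hy0 hnΓy hnz hnz0 with h | hlow
  · exact ⟨-1, by simp, by simpa [neg_div] using h.neg⟩
  refine ⟨0, by simp, tendsto_order.2 ⟨fun b hb => ?_, hup⟩⟩
  filter_upwards [hlow (-b) (neg_pos.2 hb)] with t ht
  rw [neg_div] at ht
  linarith

end PerturbedODE

theorem mainTheorem4 (f g : ℝ → ℝ)
    (hf_cont : Continuous f) (hf_mono : Monotone f) (hf_odd : Function.Odd f)
    (hf_stable : PerturbedODE.GloballyStable f)
    (hf_ap : PerturbedODE.AsymptoticPreserving f)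
    (hf_sub : PerturbedODE.SubproportionalAtZero f)
    (hg_cont : ContinuousOn g (Set.Ici 0))
    (hg_int : PerturbedODE.ImproperConvergent g)
    (hΓ : Filter.Tendsto (fun t : ℝ => PerturbedODE.tailGamma g t / PerturbedODE.decayFInv f t)
      Filter.atTop (nhds 0))
    (ξ : ℝ) (x : ℝ → ℝ) (hx : PerturbedODE.IsSolution f g ξ x) :
    ∃ l ∈ ({-1, 0, 1} : Set ℝ),
      Filter.Tendsto (fun t : ℝ => x t / PerturbedODE.decayFInv f t) Filter.atTop (nhds l) := by
  have hypos := fun (t : ℝ) (ht : 0 < t) =>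
    PerturbedODE.decayFInv_pos hf_cont hf_mono hf_stable hf_sub ht.le
  have hz : ∀ t, 0 < t → HasDerivAt (fun s => x s - PerturbedODE.tailGamma g s)
      (-f (x t - PerturbedODE.tailGamma g t + PerturbedODE.tailGamma g t)) t := fun t ht => by
    refine ((hx.2.2 t ht).sub
      (PerturbedODE.hasDerivAt_tailGamma hg_cont hg_int ht)).congr_deriv ?_
    rw [sub_add_cancel, add_sub_cancel_right]
  obtain ⟨l, hl, hlim⟩ := PerturbedODE.exists_tendsto_div hf_cont hf_mono hf_odd hf_stable hf_ap
    hf_sub hypos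
    (fun t ht => PerturbedODE.hasDerivAt_decayFInv hf_cont hf_mono hf_stable hf_sub ht)
    (PerturbedODE.tendsto_decayFInv hf_cont hf_mono hf_stable hf_sub) hΓ hz
  refine ⟨l, hl, ?_⟩
  have h := hlim.add hΓ
  rw [add_zero] at h
  refine h.congr fun t => ?_
  rw [← add_div, sub_add_cancel]
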